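/- **Notation.** Inequalities $\preceq,\prec$ (and $\succeq,\succ$), absolute values, maxima and limits of vectors and matrices are componentwise ($x\prec y$ means $x_j<y_j$ for every $j$); $\mathbb{R}^m_{+0}$ is the set of nonnegative vectors in $\mathbb{R}^m$. A function $f:\mathbb{R}^n_{+0}\to\mathbb{R}^m_{+0}$ is called CNI if $0\preceq x_1\preceq x_2$ implies $f(x_1)\preceq f(x_2)$. A real square matrix is Hurwitz if all its eigenvalues have negative real part. For $B\in\mathbb{C}^{n\times n}$, $\mathcal{M}(B)\in\mathbb{R}^{n\times n}$ has entries $\operatorname{Re}B_{j,j}$ on the diagonal and $|B_{j,l}|$ for $j\ne l$. **System.** Let $n,N\ge 1$, $\bar\tau\ge 0$, and for $i\in\{1,\dots,N\}$ let $A_i\in\mathbb{R}^{n\times n}$, $H_i\in\mathbb{R}^{n\times k_i}$, and let $\delta_i:\mathbb{R}^n_{+0}\to\mathbb{R}^{k_i}_{+0}$ be continuous and CNI. A trajectory is a function $x:[-\bar\tau,\infty)\to\mathbb{R}^n$ that is continuous, locally absolutely continuous on $[0,\infty)$, and satisfies $$\dot x(t)=A_{\sigma(t)}x(t)+H_{\sigma(t)}w_{\sigma(t)}(t)\quad\text{for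 almost every } t\ge 0,$$ for some switching function $\sigma$ with values in $\{1,\dots,N\}$ and some perturbations $w_i(t)\in\mathbb{R}^{k_i}$ with $$|w_i(t)|\preceq\delta_i(\theta(t))\ \text{ for all } t\ge 0 \text{ and all } i,\qquad \theta(t)=\max_{t-\bar\tau\le s\le t}|x(s)|.$$ **Theorem.** Let $V\in\mathbb{C}^{n\times n}$ be invertible and suppose that $\Lambda=\max_i\mathcal{M}(V^{-1}A_iV)$ is Hurwitz. Let $$\psi(x)=\max_i\ \max_{w\in\mathbb{R}^{k_i},\,|w|\preceq\delta_i(|V|x)}|V^{-1}H_iw| ,$$ let $\delta:\mathbb{R}^n_{+0}\to\mathbb{R}^n_{+0}$ be continuous and CNI with $\delta(x)\succeq\psi(x)$ for all $x\in\mathbb{R}^n_{+0}$, and for $\gamma\in\mathbb{R}^n_{+0}$ let $T_\gamma(x)=-\Lambda^{-1}\delta(x)+\gamma$. Let $\beta\in\mathbb{R}^n_{+0}$ satisfy $T_0(\beta)\prec\beta$. Then every $T_\gamma$, $\gamma\in\mathbb{R}^n_{+0}$, maps $\mathbb{R}^n_{+0}$ into itself, and: (a) $T_0^{k+1}(\beta)\preceq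 T_0^k(\beta)$ for every integer $k\ge 0$, and $\lim_{k\to\infty}T_0^k(\beta)=b$ for some $b\succeq 0$. (b) Let $\gamma\in\mathbb{R}^n_{+0}$ satisfy $-\Lambda^{-1}\big[\delta(\beta)+\max\{-\Lambda\gamma,0\}\big]\prec\beta$. If a trajectory satisfies $|V^{-1}x(t)|\preceq T_\gamma(\beta)$ for all $-\bar\tau\le t\le 0$, then $|V^{-1}x(t)|\preceq\beta$ for all $t\ge-\bar\tau$. (c) For every $c\in\mathbb{R}^n$ with $c\succ 0$ let $p(c)=\max\{-\Lambda c,0\}$. Then $p(c)\ne 0$, the set $\{j:[-\Lambda^{-1}p(c)]_j\ne 0\}$ is nonempty, $$\bar\epsilon=\min_{j:\,[-\Lambda^{-1}p(c)]_j\neq 0}\ \frac{[\beta+\Lambda^{-1}\delta(\beta)]_j}{[-\Lambda^{-1}p(c)]_j}>0,$$ and for every $0<\epsilon<\bar\epsilon$ the vector $\gamma=\epsilon c$ satisfies $-\Lambda^{-1}\big[\delta(\beta)+\max\{-\Lambda\gamma,0\}\big]\prec\beta$. (d) If a trajectory satisfies $|V^{-1}x(t)|\preceq\beta$ for all $t\ge-\bar\tau$,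 then $\limsup_{t\to\infty}|V^{-1}x(t)|\preceq b$, with $b$ as in (a). -/

import Mathlib

open Set Filter Topology MeasureTheory
open scoped Matrix

noncomputable section

namespace SwitchingSystem

/-- The nonnegative orthant of `ℝ^m`, with the componentwise order. -/
abbrev orthant (m : ℕ) : Set (Fin m → ℝ) := Set.Ici 0

/-- Componentwise monotone functions from a nonnegative orthant to a nonnegative orthant.
Values outside the orthant are irrelevant. -/
structure IsCNI {n m : ℕ} (f : (Fin n → ℝ) → (Fin m → ℝ)) : Prop where
  mapsTo : MapsTo f (orthant n) (orthant m)
  monotoneOn : MonotoneOn f (orthant n)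

/-- All (complex) eigenvalues of the real matrix `L` have negative real part. -/
def IsHurwitz {n : ℕ} (L : Matrix (Fin n) (Fin n) ℝ) : Prop :=
  ∀ μ ∈ spectrum ℂ (L.map Complex.ofReal), μ.re < 0

/-- The operation `M(·)`: real parts on the diagonal, moduli off the diagonal. -/
def metzlerPart {n : ℕ} (B : Matrix (Fin n) (Fin n) ℂ) : Matrix (Fin n) (Fin n) ℝ :=
  Matrix.of fun j l => if j = l then (B j l).re else ‖B j l‖

/-- `Λ`, the entrywise maximum over `i` of `M(V⁻¹ A_i V)`. -/
def lamMat {n N : ℕ} [NeZero N] (V : Matrix (Fin n) (Fin n) ℂ)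
    (A : Fin N → Matrix (Fin n) (Fin n) ℝ) : Matrix (Fin n) (Fin n) ℝ :=
  Matrix.of fun j l => Finset.univ.sup' Finset.univ_nonempty
    fun i => metzlerPart (V⁻¹ * (A i).map Complex.ofReal * V) j l

/-- The vector of moduli `|B v|`, for a complex matrix `B` and a real vector `v`. -/
def absMulVec {n m : ℕ} (B : Matrix (Fin n) (Fin m) ℂ) (v : Fin m → ℝ) : Fin n → ℝ :=
  fun j => ‖(B *ᵥ fun l => (v l : ℂ)) j‖

/-- The matrix of moduli `|B|`. -/
def absMat {n m : ℕ} (B : Matrix (Fin n) (Fin m) ℂ) : Matrix (Fin n) (Fin m) ℝ :=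
  B.map fun z => ‖z‖

/-- `ψ(x) = max_i max_{|w| ⪯ δ_i(|V| x)} |V⁻¹ H_i w|`, componentwise. -/
def psi {n N : ℕ} [NeZero N] {k : Fin N → ℕ} (V : Matrix (Fin n) (Fin n) ℂ)
    (H : ∀ i, Matrix (Fin n) (Fin (k i)) ℝ)
    (dl : ∀ i, (Fin n → ℝ) → (Fin (k i) → ℝ)) (x : Fin n → ℝ) : Fin n → ℝ :=
  fun j => Finset.univ.sup' Finset.univ_nonempty fun i =>
    sSup ((fun w : Fin (k i) → ℝ => absMulVec (V⁻¹ * (H i).map Complex.ofReal) w j) ''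
      {w | |w| ≤ dl i (absMat V *ᵥ x)})

/-- `T_γ(x) = -Λ⁻¹ δ(x) + γ`. -/
def tMap {n : ℕ} (L : Matrix (Fin n) (Fin n) ℝ) (δ : (Fin n → ℝ) → (Fin n → ℝ))
    (γ x : Fin n → ℝ) : Fin n → ℝ :=
  -(L⁻¹ *ᵥ δ x) + γ

/-- `θ(t)`, the componentwise maximum of `|x(s)|` over `t - τ ≤ s ≤ t`. -/
def delayMax {n : ℕ} (τ : ℝ) (x : ℝ → Fin n → ℝ) (t : ℝ) : Fin n → ℝ :=
  fun j => sSup ((fun s => |x s j|) '' Icc (t - τ) t)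

/-- `x` is a trajectory on `[-τ, ∞)` of `x' = A_σ x + H_σ w_σ` (in the sense of Carathéodory, which
contains the classical and the piecewise classical sense) for the switching function `σ` and the
perturbations `w`, and the perturbations obey `|w_i(t)| ⪯ δ_i(θ(t))` for `t ≥ 0`. -/
structure IsTrajectory {n N : ℕ} {k : Fin N → ℕ}
    (A : Fin N → Matrix (Fin n) (Fin n) ℝ) (H : ∀ i, Matrix (Fin n) (Fin (k i)) ℝ)
    (dl : ∀ i, (Fin n → ℝ) → (Fin (k i) → ℝ)) (τ : ℝ)
    (σ : ℝ → Fin N) (w : ∀ i, ℝ → Fin (k i) → ℝ) (x : ℝ → Fin n → ℝ) : Prop where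
  continuousOn : ContinuousOn x (Ici (-τ))
  absolutelyContinuous : ∀ t, 0 ≤ t → AbsolutelyContinuousOnInterval x 0 t
  ode : ∀ᵐ t : ℝ, 0 ≤ t →
    HasDerivAt x (A (σ t) *ᵥ x t + H (σ t) *ᵥ w (σ t) t) t
  bound : ∀ t, 0 ≤ t → ∀ i, |w i t| ≤ dl i (delayMax τ x t)

/-- The vector `p(c) = max {-Λ c, 0}`. -/
def pVec {n : ℕ} (L : Matrix (Fin n) (Fin n) ℝ) (c : Fin n → ℝ) : Fin n → ℝ :=
  fun j => if 0 < (-(L *ᵥ c)) j then (-(L *ᵥ c)) j else 0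

/-- The indices `j` with `[-Λ⁻¹ p(c)]_j ≠ 0`. -/
def pSupport {n : ℕ} (L : Matrix (Fin n) (Fin n) ℝ) (c : Fin n → ℝ) : Finset (Fin n) :=
  Finset.univ.filter fun j => (-(L⁻¹ *ᵥ pVec L c)) j ≠ 0

/-- The bound `ε̄`, a minimum over a nonempty finite index set. -/
def epsBar {n : ℕ} (L : Matrix (Fin n) (Fin n) ℝ) (δ : (Fin n → ℝ) → (Fin n → ℝ))
    (β c : Fin n → ℝ) (h : (pSupport L c).Nonempty) : ℝ :=
  (pSupport L c).inf' h fun j => (β + L⁻¹ *ᵥ δ β) j / (-(L⁻¹ *ᵥ pVec L c)) j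

/-- The condition `-Λ⁻¹ [δ(β) + max {-Λ γ, 0}] ≺ β` on `γ`. -/
def Admissible {n : ℕ} (L : Matrix (Fin n) (Fin n) ℝ) (δ : (Fin n → ℝ) → (Fin n → ℝ))
    (β γ : Fin n → ℝ) : Prop :=
  StrongLT (-(L⁻¹ *ᵥ (δ β + (-(L *ᵥ γ)) ⊔ 0))) β

end SwitchingSystem

end

/-!
The vector of moduli `u(t) = |V⁻¹ x(t)|` of a trajectory satisfies `u' ≤ Λ u + δ(max u)`, with the
maximum over the delay window, whatever the switching function and the perturbations are. As `Λ`
is Metzler and Hurwitz, `Λ v` is negative for some positive weight vector `v`. If `u ≤ ζ` and `η`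
is a supersolution for `ζ`, that is `Λ η + δ(ζ) ≤ 0`, then the least `e ≥ 0` with `u ≤ η + e v`
decays exponentially in time. Hence a supersolution `η ≺ ζ` that bounds the initial
data keeps `u` below `η`, so that `u` can never leave the region below `ζ`; this gives (b). Applied
to `η = T₀ ζ`, with `ζ` slightly above `ℓ = limsup u`, the decay gives `ℓ ≤ T₀ ℓ`. By monotonicity
`ℓ ≤ T₀ᵏ β` for all `k`, which is (d) in the limit.
-/

namespace SwitchingSystem

section Metzler

variable {ι : Type*}

/-- A real matrix is Metzler if its off-diagonal entries are nonnegative. -/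
def IsMetzler (L : Matrix ι ι ℝ) : Prop :=
  Pairwise fun j l => 0 ≤ L j l

theorem IsMetzler.sub_smul_one [DecidableEq ι] {L : Matrix ι ι ℝ} (hL : IsMetzler L) (s : ℝ) :
    IsMetzler (L - s • 1) := by
  intro j l hjl
  simpa [Matrix.one_apply_ne hjl] using hL hjl

variable [Fintype ι] {L : Matrix ι ι ℝ}

/-- A Metzler matrix `L` for which `-L` is a nonsingular M-matrix. Of the many equivalent
characterizations, the encoding is by a positive vector that `L` maps to a negative one; such a
vector serves as the weight in comparison arguments. -/
structure IsStableMetzler (L : Matrix ι ι ℝ) : Prop where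
  isMetzler : IsMetzler L
  exists_mulVec_neg : ∃ v, StrongLT 0 v ∧ StrongLT (L *ᵥ v) 0

theorem IsMetzler.mulVec_apply_le (hL : IsMetzler L) {u v : ι → ℝ} (huv : u ≤ v) {j : ι}
    (hj : u j = v j) : (L *ᵥ u) j ≤ (L *ᵥ v) j := by
  refine Finset.sum_le_sum fun l _ => ?_
  obtain rfl | hjl := eq_or_ne j l
  · rw [hj]
  · exact mul_le_mul_of_nonneg_left (huv l) (hL hjl)

theorem IsMetzler.isStableMetzler (hL : IsMetzler L) {v : ι → ℝ} (hv : 0 ≤ v)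
    (hLv : StrongLT (L *ᵥ v) 0) : IsStableMetzler L := by
  refine ⟨hL, v, fun j => (hv j).lt_of_ne fun hj => ?_, hLv⟩
  have hle : (L *ᵥ 0) j ≤ (L *ᵥ v) j := hL.mulVec_apply_le hv hj
  rw [Matrix.mulVec_zero] at hle
  exact hle.not_gt (hLv j)

theorem IsStableMetzler.nonneg_of_mulVec_nonpos (hL : IsStableMetzler L) {u : ι → ℝ}
    (hu : L *ᵥ u ≤ 0) : 0 ≤ u := by
  obtain ⟨v, hv, hLv⟩ := hL.exists_mulVec_neg
  intro i
  obtain ⟨j, -, hj⟩ := Finset.exists_min_image Finset.univ (fun l => u l / v l)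
    ⟨i, Finset.mem_univ i⟩
  have hmin : (u j / v j) • v ≤ u := fun l => (le_div_iff₀ (hv l)).1 (hj l (Finset.mem_univ l))
  have hratio : 0 ≤ u j / v j := by
    by_contra! hneg
    have hle : (L *ᵥ ((u j / v j) • v)) j ≤ (L *ᵥ u) j :=
      hL.isMetzler.mulVec_apply_le hmin (div_mul_cancel₀ _ (hv j).ne')
    rw [Matrix.mulVec_smul] at hle
    exact (mul_pos_of_neg_of_neg hneg (hLv j)).not_ge (hle.trans (hu j))
  exact (mul_nonneg hratio (hv i).le).trans (hmin i)

theorem IsStableMetzler.exists_mulVec_le_smul (hL : IsStableMetzler L) :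
    ∃ v, StrongLT 0 v ∧ ∃ r < (0 : ℝ), L *ᵥ v ≤ r • v := by
  obtain ⟨v, hv, hLv⟩ := hL.exists_mulVec_neg
  have hev : ∀ᶠ r : ℝ in 𝓝[<] 0, ∀ j, (L *ᵥ v) j < r * v j := eventually_all.2 fun j =>
    (((continuous_mul_const (v j)).tendsto' 0 0 (zero_mul _)).mono_left
      nhdsWithin_le_nhds).eventually (lt_mem_nhds (hLv j))
  obtain ⟨r, hr, hr0⟩ := (hev.and self_mem_nhdsWithin).exists
  exact ⟨v, hv, r, hr0, fun j => (hr j).le⟩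

variable [DecidableEq ι]

theorem IsStableMetzler.isUnit (hL : IsStableMetzler L) : IsUnit L := by
  refine Matrix.mulVec_injective_iff_isUnit.1
    ((injective_iff_map_eq_zero L.mulVecLin).2 fun u hu => le_antisymm ?_ ?_)
  · exact neg_nonneg.1 (hL.nonneg_of_mulVec_nonpos
      ((Matrix.mulVec_neg u L).trans (neg_eq_zero.2 hu)).le)
  · exact hL.nonneg_of_mulVec_nonpos (le_of_eq hu)

theorem IsStableMetzler.mulVec_inv_mulVec (hL : IsStableMetzler L) (u : ι → ℝ) :
    L *ᵥ (L⁻¹ *ᵥ u) = u := by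
  rw [Matrix.mulVec_mulVec, Matrix.mul_nonsing_inv _ (L.isUnit_iff_isUnit_det.1 hL.isUnit),
    Matrix.one_mulVec]

theorem IsStableMetzler.inv_mulVec_mulVec (hL : IsStableMetzler L) (u : ι → ℝ) :
    L⁻¹ *ᵥ (L *ᵥ u) = u := by
  rw [Matrix.mulVec_mulVec, Matrix.nonsing_inv_mul _ (L.isUnit_iff_isUnit_det.1 hL.isUnit),
    Matrix.one_mulVec]

theorem IsStableMetzler.neg_inv_mulVec_nonneg (hL : IsStableMetzler L) {u : ι → ℝ}
    (hu : 0 ≤ u) : 0 ≤ -(L⁻¹ *ᵥ u) := by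
  refine hL.nonneg_of_mulVec_nonpos ?_
  rw [Matrix.mulVec_neg, hL.mulVec_inv_mulVec]
  exact neg_nonpos.2 hu

theorem IsStableMetzler.monotone_neg_inv_mulVec (hL : IsStableMetzler L) :
    Monotone fun u => -(L⁻¹ *ᵥ u) := by
  intro u v huv
  have hsub := hL.neg_inv_mulVec_nonneg (sub_nonneg.2 huv)
  rw [Matrix.mulVec_sub, neg_sub] at hsub
  exact neg_le_neg (sub_nonneg.1 hsub)

theorem IsMetzler.exists_isStableMetzler_sub_smul_one (hL : IsMetzler L) :
    ∃ s : ℝ, 0 ≤ s ∧ IsStableMetzler (L - s • 1) := by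
  refine ⟨‖L *ᵥ 1‖ + 1, by positivity, (hL.sub_smul_one _).isStableMetzler zero_le_one fun j => ?_⟩
  have hle := (Real.le_norm_self _).trans (norm_le_pi_norm (L *ᵥ 1) j)
  simp only [Matrix.sub_mulVec, Matrix.smul_mulVec, Matrix.one_mulVec, Pi.sub_apply,
    Pi.smul_apply, Pi.one_apply, Pi.zero_apply, smul_eq_mul, mul_one]
  linarith

theorem IsMetzler.isOpen_setOf_isStableMetzler_sub_smul_one (hL : IsMetzler L) :
    IsOpen {s : ℝ | IsStableMetzler (L - s • 1)} := by
  refine isOpen_iff_mem_nhds.2 fun s hs => ?_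
  obtain ⟨v, hv, hLv⟩ := hs.exists_mulVec_neg
  have hcont : Continuous fun r : ℝ => (L - r • (1 : Matrix ι ι ℝ)) *ᵥ v := by fun_prop
  have hev : ∀ᶠ r in 𝓝 s, ∀ j, ((L - r • (1 : Matrix ι ι ℝ)) *ᵥ v) j < 0 :=
    eventually_all.2 fun j =>
      ((continuous_apply j).comp hcont).continuousAt.eventually (gt_mem_nhds (hLv j))
  filter_upwards [hev] with r hr
  exact (hL.sub_smul_one r).isStableMetzler hv.le hr

theorem IsMetzler.isStableMetzler_of_mem_closure (hL : IsMetzler L) (hunit : IsUnit L)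
    (hmem : L ∈ closure {M | IsStableMetzler M}) : IsStableMetzler L := by
  have hdet : IsUnit L.det := L.isUnit_iff_isUnit_det.1 hunit
  have hinv : ContinuousAt (Inv.inv : Matrix ι ι ℝ → Matrix ι ι ℝ) L :=
    continuousAt_matrix_inv L (by
      rw [Ring.inverse_eq_inv']
      exact continuousAt_inv₀ hdet.ne_zero)
  have hcont : ContinuousAt (fun M : Matrix ι ι ℝ => -(M⁻¹ *ᵥ 1)) L :=
    ((continuous_id.matrix_mulVec continuous_const).continuousAt.comp hinv).neg
  have hnonneg : 0 ≤ -(L⁻¹ *ᵥ 1) := isClosed_Ici.mem_of_frequently_of_tendsto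
    ((mem_closure_iff_frequently.1 hmem).mono fun M hM => hM.neg_inv_mulVec_nonneg zero_le_one)
    hcont
  refine hL.isStableMetzler hnonneg fun j => ?_
  rw [Matrix.mulVec_neg, Matrix.mulVec_mulVec, Matrix.mul_nonsing_inv _ hdet, Matrix.one_mulVec]
  exact neg_one_lt_zero

/-- Continuation in `s` from large `s` down to `0`: stability of `L - s` is an open condition, and
it can only be lost at a singular `L - s`. -/
theorem IsMetzler.isStableMetzler_of_spectrum_neg (hL : IsMetzler L)
    (hspec : ∀ s ∈ spectrum ℝ L, s < 0) : IsStableMetzler L := by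
  have hsub : Ici (0 : ℝ) ⊆ {s : ℝ | IsStableMetzler (L - s • 1)} := by
    refine isPreconnected_Ici.subset_of_closure_inter_subset
      hL.isOpen_setOf_isStableMetzler_sub_smul_one hL.exists_isStableMetzler_sub_smul_one ?_
    rintro s ⟨hs, hs0⟩
    have hunit : IsUnit (L - s • 1) := by
      have hres := spectrum.notMem_iff.1 fun h => (hspec s h).not_ge hs0
      rwa [Algebra.algebraMap_eq_smul_one, IsUnit.sub_iff] at hres
    have hcont : Continuous fun r : ℝ => L - r • (1 : Matrix ι ι ℝ) := by fun_prop
    exact (hL.sub_smul_one s).isStableMetzler_of_mem_closure hunit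
      (hcont.closure_preimage_subset _ hs)
  simpa using hsub self_mem_Ici

end Metzler

theorem IsHurwitz.neg_of_mem_spectrum {n : ℕ} {L : Matrix (Fin n) (Fin n) ℝ} (h : IsHurwitz L)
    {s : ℝ} (hs : s ∈ spectrum ℝ L) : s < 0 := by
  refine h s ?_
  rw [Matrix.mem_spectrum_iff_isRoot_charpoly] at hs ⊢
  exact L.charpoly_map Complex.ofRealHom ▸ hs.map

section AbsolutelyContinuous

theorem absolutelyContinuousOnInterval_comp_of_lipschitzWith {X Y : Type*}
    [PseudoMetricSpace X] [PseudoMetricSpace Y] {K : NNReal} {g : X → Y} (hg : LipschitzWith K g)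
    {f : ℝ → X} {a b : ℝ} (hf : AbsolutelyContinuousOnInterval f a b) :
    AbsolutelyContinuousOnInterval (fun t => g (f t)) a b := by
  refine squeeze_zero (fun E => Finset.sum_nonneg fun i _ => dist_nonneg) (fun E => ?_)
    (by simpa using Tendsto.const_mul (K : ℝ) hf)
  rw [Finset.mul_sum]
  exact Finset.sum_le_sum fun i _ => hg.dist_le_mul _ _

theorem ae_differentiableAt_pi_of_absolutelyContinuousOnInterval {ι : Type*} [Fintype ι]
    {f : ℝ → ι → ℝ} {a b : ℝ} (hf : AbsolutelyContinuousOnInterval f a b) :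
    ∀ᵐ t, t ∈ uIcc a b → DifferentiableAt ℝ f t := by
  have hcoord : ∀ j, ∀ᵐ t, t ∈ uIcc a b → DifferentiableAt ℝ (fun s => f s j) t := fun j =>
    (absolutelyContinuousOnInterval_comp_of_lipschitzWith (LipschitzWith.eval j)
      hf).ae_differentiableAt
  filter_upwards [ae_all_iff.2 hcoord] with t ht hmem
  exact differentiableAt_pi.2 fun j => ht j hmem

theorem le_of_ae_deriv_nonpos {f : ℝ → ℝ} {a b : ℝ} (hab : a ≤ b)
    (hf : AbsolutelyContinuousOnInterval f a b) (hderiv : ∀ᵐ t, t ∈ Icc a b → deriv f t ≤ 0) :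
    f b ≤ f a := by
  have hint : 0 ≤ ∫ t in a..b, -deriv f t := by
    refine intervalIntegral.integral_nonneg_of_ae_restrict hab ?_
    rw [EventuallyLE, ae_restrict_iff' measurableSet_Icc]
    filter_upwards [hderiv] with t ht hmem using neg_nonneg.2 (ht hmem)
  rwa [intervalIntegral.integral_neg, hf.integral_deriv_eq_sub, neg_sub, sub_nonneg] at hint

theorem le_mul_exp_of_ae_deriv_le_mul {f : ℝ → ℝ} {a b r : ℝ} (hab : a ≤ b)
    (hf : AbsolutelyContinuousOnInterval f a b)
    (hderiv : ∀ᵐ t, t ∈ Icc a b → deriv f t ≤ r * f t) :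
    f b ≤ f a * Real.exp (r * (b - a)) := by
  have hexp : AbsolutelyContinuousOnInterval (fun t => Real.exp (-(r * (t - a)))) a b :=
    ContDiffOn.absolutelyContinuousOnInterval (by fun_prop)
  have hle : f b * Real.exp (-(r * (b - a))) ≤ f a * Real.exp (-(r * (a - a))) := by
    refine le_of_ae_deriv_nonpos hab (hf.fun_mul hexp) ?_
    filter_upwards [hderiv, hf.ae_differentiableAt] with t ht hdiff hmem
    have hf' := (hdiff (by rwa [uIcc_of_le hab])).hasDerivAt
    have hexp' : HasDerivAt (fun t => Real.exp (-(r * (t - a))))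
        (Real.exp (-(r * (t - a))) * -(r * 1)) t :=
      (((hasDerivAt_id t).sub_const a).const_mul r).fun_neg.exp
    rw [(hf'.fun_mul hexp').deriv]
    linarith [mul_le_mul_of_nonneg_right (ht hmem) (Real.exp_pos (-(r * (t - a)))).le]
  simpa [Real.exp_neg, mul_inv_le_iff₀ (Real.exp_pos _)] using hle

end AbsolutelyContinuous


section Excess

variable {ι : Type*} [Fintype ι] {L : Matrix ι ι ℝ} {η v p : ι → ℝ}

/-- The least `e ≥ 0` such that `u ≤ η + e • v`, for a positive weight vector `v`. -/
noncomputable def excess (η v u : ι → ℝ) : ℝ :=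
  ‖fun j => max ((u j - η j) / v j) 0‖

theorem excess_nonneg (η v u : ι → ℝ) : 0 ≤ excess η v u :=
  norm_nonneg _

theorem le_add_excess_smul (η : ι → ℝ) (hv : StrongLT 0 v) (u : ι → ℝ) :
    u ≤ η + excess η v u • v := by
  intro j
  have hle : (u j - η j) / v j ≤ excess η v u :=
    (le_max_left _ 0).trans ((Real.le_norm_self _).trans
      (norm_le_pi_norm (fun j => max ((u j - η j) / v j) 0) j))
  exact sub_le_iff_le_add'.1 ((div_le_iff₀ (hv j)).1 hle)

theorem exists_eq_add_excess_smul (hv : StrongLT 0 v) {u : ι → ℝ} (hpos : 0 < excess η v u) :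
    ∃ j, u j = (η + excess η v u • v) j := by
  by_contra! hne
  refine lt_irrefl (excess η v u) ((pi_norm_lt_iff hpos).2 fun j => ?_)
  have hlt : u j < η j + excess η v u * v j := (le_add_excess_smul η hv u j).lt_of_ne (hne j)
  rw [Real.norm_of_nonneg (le_max_right _ _), max_lt_iff, div_lt_iff₀ (hv j)]
  exact ⟨sub_lt_iff_lt_add'.2 hlt, hpos⟩

theorem excess_eq_zero (hv : StrongLT 0 v) {u : ι → ℝ} (hu : u ≤ η) : excess η v u = 0 := by
  refine norm_eq_zero.2 (funext fun j => max_eq_right ?_)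
  exact div_nonpos_of_nonpos_of_nonneg (sub_nonpos.2 (hu j)) (hv j).le

theorem lipschitzWith_excess (η v : ι → ℝ) : LipschitzWith ‖v⁻¹‖₊ (excess η v) := by
  refine LipschitzWith.of_dist_le_mul fun u u' => (dist_norm_norm_le _ _).trans
    ((pi_norm_le_iff_of_nonneg (by positivity)).2 fun j => ?_)
  calc |max ((u j - η j) / v j) 0 - max ((u' j - η j) / v j) 0|
      ≤ |(u j - η j) / v j - (u' j - η j) / v j| := abs_max_sub_max_le_abs _ _ _
    _ = ‖(v⁻¹) j‖ * dist (u j) (u' j) := by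
        rw [← sub_div, sub_sub_sub_cancel_right, div_eq_inv_mul, abs_mul, Real.dist_eq]
        rfl
    _ ≤ ‖v⁻¹‖ * dist u u' := by
        gcongr
        exacts [norm_le_pi_norm _ j, dist_le_pi_dist u u' j]

/-- Where the excess is positive it is attained in some coordinate `j`, and there
`η j + excess η v u * v j - u j` has a minimum in time, which identifies the derivative of the
excess. -/
theorem IsMetzler.deriv_excess_le (hL : IsMetzler L) (hv : StrongLT 0 v) {r : ℝ}
    (hLv : L *ᵥ v ≤ r • v) (hη : L *ᵥ η + p ≤ 0) {u : ℝ → ι → ℝ} {u' : ι → ℝ} {t d : ℝ}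
    (hu : HasDerivAt u u' t) (hu' : u' ≤ L *ᵥ u t + p)
    (hd : HasDerivAt (fun s => excess η v (u s)) d t) : d ≤ r * excess η v (u t) := by
  obtain hzero | hpos := (excess_nonneg η v (u t)).eq_or_lt
  · have hmin : IsLocalMin (fun s => excess η v (u s)) t :=
      Eventually.of_forall fun s => hzero.symm.trans_le (excess_nonneg η v (u s))
    rw [hmin.hasDerivAt_eq_zero hd, ← hzero, mul_zero]
  obtain ⟨j, hj⟩ := exists_eq_add_excess_smul hv hpos
  have hmin : IsLocalMin (fun s => (η + excess η v (u s) • v) j - u s j) t :=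
    Eventually.of_forall fun s => by
      simpa only [← hj, sub_self, sub_nonneg] using le_add_excess_smul η hv (u s) j
  have hderiv : d * v j = u' j := sub_eq_zero.1
    (hmin.hasDerivAt_eq_zero (((hd.mul_const (v j)).const_add (η j)).sub (hasDerivAt_pi.1 hu j)))
  have hcomp : (L *ᵥ u t) j ≤ (L *ᵥ η) j + excess η v (u t) * (L *ᵥ v) j := by
    have := hL.mulVec_apply_le (le_add_excess_smul η hv (u t)) hj
    rwa [Matrix.mulVec_add, Matrix.mulVec_smul] at this
  refine le_of_mul_le_mul_right ?_ (hv j)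
  calc d * v j ≤ (L *ᵥ u t) j + p j := hderiv.trans_le (hu' j)
    _ ≤ ((L *ᵥ η) j + p j) + excess η v (u t) * (L *ᵥ v) j := by linarith
    _ ≤ 0 + excess η v (u t) * (r * v j) := by
        gcongr
        exacts [hη j, hLv j]
    _ = r * excess η v (u t) * v j := by ring

end Excess

section DelaySubsolution

variable {ι : Type*} [Fintype ι]

/-- Nonnegative subsolutions on `[0, ∞)` of the delay equation
`u' = L u + δ(max_{t - τ ≤ s ≤ t} u(s))`. The maximum over the delay window is encoded by
quantifying over all upper bounds `ζ` of the window, which amounts to the same for a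
monotone `δ`. -/
structure IsDelaySubsolution (L : Matrix ι ι ℝ) (δ : (ι → ℝ) → ι → ℝ) (τ : ℝ)
    (u : ℝ → ι → ℝ) : Prop where
  nonneg : ∀ t, 0 ≤ u t
  absolutelyContinuous : ∀ t, 0 ≤ t → AbsolutelyContinuousOnInterval u 0 t
  deriv_le : ∀ᵐ t, 0 ≤ t → ∀ ζ, (∀ s ∈ Icc (t - τ) t, u s ≤ ζ) →
    ∀ u', HasDerivAt u u' t → u' ≤ L *ᵥ u t + δ ζ

namespace IsDelaySubsolution

variable {L : Matrix ι ι ℝ} {δ : (ι → ℝ) → ι → ℝ} {τ : ℝ} {u : ℝ → ι → ℝ} {ζ η v : ι → ℝ}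

theorem excess_le (hu : IsDelaySubsolution L δ τ u) (hL : IsMetzler L) (hv : StrongLT 0 v) {r : ℝ}
    (hLv : L *ᵥ v ≤ r • v) (hη : L *ᵥ η + δ ζ ≤ 0) {a b : ℝ} (ha : 0 ≤ a) (hab : a ≤ b)
    (hζ : ∀ s ∈ Icc (a - τ) b, u s ≤ ζ) :
    excess η v (u b) ≤ excess η v (u a) * Real.exp (r * (b - a)) := by
  have hac : AbsolutelyContinuousOnInterval u a b := by
    refine (hu.absolutelyContinuous b (ha.trans hab)).mono ?_
    rw [uIcc_of_le hab, uIcc_of_le (ha.trans hab)]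
    exact Icc_subset_Icc_left ha
  have hac_excess :=
    absolutelyContinuousOnInterval_comp_of_lipschitzWith (lipschitzWith_excess η v) hac
  refine le_mul_exp_of_ae_deriv_le_mul hab hac_excess ?_
  filter_upwards [hu.deriv_le, ae_differentiableAt_pi_of_absolutelyContinuousOnInterval hac,
    hac_excess.ae_differentiableAt] with t hderiv hdiff hdiff_excess ht
  have htu : t ∈ uIcc a b := by rwa [uIcc_of_le hab]
  have hwindow : ∀ s ∈ Icc (t - τ) t, u s ≤ ζ := fun s hs =>
    hζ s ⟨(sub_le_sub_right ht.1 τ).trans hs.1, hs.2.trans ht.2⟩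
  exact hL.deriv_excess_le hv hLv hη (hdiff htu).hasDerivAt
    (hderiv (ha.trans ht.1) ζ hwindow _ (hdiff htu).hasDerivAt) (hdiff_excess htu).hasDerivAt

theorem continuousOn (hu : IsDelaySubsolution L δ τ u) {t : ℝ} (ht : 0 ≤ t) :
    ContinuousOn u (Icc 0 t) :=
  uIcc_of_le ht ▸ (hu.absolutelyContinuous t ht).continuousOn

theorem le_of_history_le (hu : IsDelaySubsolution L δ τ u) (hL : IsStableMetzler L)
    (hη : L *ᵥ η + δ ζ ≤ 0) {t : ℝ} (ht : 0 ≤ t) (hζ : ∀ s ∈ Icc (-τ) t, u s ≤ ζ)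
    (hu0 : u 0 ≤ η) : u t ≤ η := by
  obtain ⟨v, hv, hLv⟩ := hL.exists_mulVec_neg
  have hexcess := hu.excess_le hL.isMetzler hv (r := 0) (by simpa using hLv.le) hη le_rfl ht
    (by simpa using hζ)
  rw [excess_eq_zero hv hu0, zero_mul] at hexcess
  simpa [le_antisymm hexcess (excess_nonneg η v _)] using le_add_excess_smul η hv (u t)

theorem le_of_initial_le (hu : IsDelaySubsolution L δ τ u) (hL : IsStableMetzler L)
    (hη : L *ᵥ η + δ ζ ≤ 0) (hlt : StrongLT η ζ) (hτ : 0 ≤ τ) (hinit : ∀ t ∈ Icc (-τ) 0, u t ≤ η)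
    {t : ℝ} (ht : -τ ≤ t) : u t ≤ ζ := by
  have hinit' : ∀ s ∈ Icc (-τ) 0, u s ≤ ζ := fun s hs => (hinit s hs).trans hlt.le
  have hzero : (0 : ℝ) ∈ Icc (-τ) 0 := right_mem_Icc.2 (neg_nonpos.2 hτ)
  obtain ht0 | ht0 := le_total t 0
  · exact hinit' t ⟨ht, ht0⟩
  suffices hsub : Icc 0 t ⊆ {s | u s ≤ ζ} from hsub ⟨ht0, le_rfl⟩
  refine IsClosed.Icc_subset_of_forall_mem_nhdsGT_of_Icc_subset ?_ (hinit' 0 hzero) ?_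
  · rw [inter_comm]
    exact (hu.continuousOn ht0).preimage_isClosed_of_isClosed isClosed_Icc isClosed_Iic
  · intro s hs hle
    have hη_le : u s ≤ η := hu.le_of_history_le hL hη hs.1
      (fun q hq => (le_total q 0).elim (fun h => hinit' q ⟨hq.1, h⟩) fun h => hle ⟨h, hq.2⟩)
      (hinit 0 hzero)
    have hcont : Tendsto u (𝓝[>] s) (𝓝 (u s)) :=
      (hu.continuousOn ht0 s ⟨hs.1, hs.2.le⟩).mono_of_mem_nhdsWithin
        (mem_of_superset (Icc_mem_nhdsGT hs.2) (Icc_subset_Icc_left hs.1))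
    filter_upwards [eventually_all.2 fun j => (tendsto_pi_nhds.1 hcont j).eventually
      (gt_mem_nhds ((hη_le j).trans_lt (hlt j)))] with q hq j using (hq j).le

theorem limsup_le (hu : IsDelaySubsolution L δ τ u) (hL : IsStableMetzler L)
    (hη : L *ᵥ η + δ ζ ≤ 0) (hζ : ∀ᶠ t in atTop, u t ≤ ζ) (j : ι) :
    limsup (fun t => u t j) atTop ≤ η j := by
  obtain ⟨v, hv, r, hr, hLv⟩ := hL.exists_mulVec_le_smul
  obtain ⟨T, hT⟩ := eventually_atTop.1 hζ
  set a := max (T + τ) 0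
  have hle : ∀ t ≥ a, u t j ≤ η j + excess η v (u a) * Real.exp (r * (t - a)) * v j := by
    intro t ht
    have hdecay := hu.excess_le hL.isMetzler hv hLv hη (le_max_right (T + τ) 0) ht
      fun s hs => hT s ((le_sub_iff_add_le.2 (le_max_left _ _)).trans hs.1)
    have hvj : 0 ≤ v j := (hv j).le
    calc u t j ≤ η j + excess η v (u t) * v j := le_add_excess_smul η hv (u t) j
      _ ≤ η j + excess η v (u a) * Real.exp (r * (t - a)) * v j := by gcongr
  have hexp : Tendsto (fun t => Real.exp (r * (t - a))) atTop (𝓝 0) :=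
    Real.tendsto_exp_atBot.comp ((tendsto_const_mul_atBot_of_neg hr).2
      (tendsto_atTop_add_const_right atTop (-a) tendsto_id))
  have hlim : Tendsto (fun t => η j + excess η v (u a) * Real.exp (r * (t - a)) * v j) atTop
      (𝓝 (η j)) := by
    simpa using ((hexp.const_mul (excess η v (u a))).mul_const (v j)).const_add (η j)
  calc limsup (fun t => u t j) atTop
      ≤ limsup (fun t => η j + excess η v (u a) * Real.exp (r * (t - a)) * v j) atTop :=
        limsup_le_limsup (eventually_atTop.2 ⟨a, hle⟩)
          (isCoboundedUnder_le_of_le atTop fun t => hu.nonneg t j) hlim.isBoundedUnder_le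
    _ = η j := hlim.limsup_eq

end IsDelaySubsolution

end DelaySubsolution

theorem antitone_iterate_of_mapsTo {α : Type*} [Preorder α] {s : Set α} {f : α → α}
    (hmaps : MapsTo f s s) (hmono : MonotoneOn f s) {x : α} (hx : x ∈ s) (hfx : f x ≤ x) :
    Antitone fun m : ℕ => f^[m] x := by
  refine antitone_nat_of_succ_le fun m => ?_
  induction m with
  | zero => exact hfx
  | succ m ih =>
    simp only [Function.iterate_succ_apply' f] at ih ⊢
    have hm : f^[m] x ∈ s := hmaps.iterate m hx
    exact hmono (hmaps hm) hm ih

section ComparisonMap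

variable {n : ℕ} {L : Matrix (Fin n) (Fin n) ℝ} {δ : (Fin n → ℝ) → Fin n → ℝ}
  {β γ : Fin n → ℝ}

theorem IsStableMetzler.mapsTo_tMap (hL : IsStableMetzler L)
    (hδ : MapsTo δ (orthant n) (orthant n)) (hγ : 0 ≤ γ) :
    MapsTo (tMap L δ γ) (orthant n) (orthant n) := fun _ hx =>
  add_nonneg (hL.neg_inv_mulVec_nonneg (hδ hx)) hγ

theorem IsStableMetzler.monotoneOn_tMap (hL : IsStableMetzler L)
    (hδ : MonotoneOn δ (orthant n)) (γ : Fin n → ℝ) : MonotoneOn (tMap L δ γ) (orthant n) :=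
  fun _ hx _ hy hxy => add_le_add_left (hL.monotone_neg_inv_mulVec (hδ hx hy hxy)) γ

theorem continuousOn_tMap (hδ : ContinuousOn δ (orthant n)) (L : Matrix (Fin n) (Fin n) ℝ)
    (γ : Fin n → ℝ) : ContinuousOn (tMap L δ γ) (orthant n) :=
  ((continuous_const.matrix_mulVec continuous_id).comp_continuousOn hδ).neg.add continuousOn_const

theorem IsStableMetzler.antitone_iterate_tMap (hL : IsStableMetzler L) (hδ : IsCNI δ) (hβ : 0 ≤ β)
    (hTβ : tMap L δ 0 β ≤ β) : Antitone fun m : ℕ => (tMap L δ 0)^[m] β :=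
  antitone_iterate_of_mapsTo (hL.mapsTo_tMap hδ.mapsTo le_rfl)
    (hL.monotoneOn_tMap hδ.monotoneOn 0) hβ hTβ

theorem IsStableMetzler.exists_tendsto_iterate_tMap (hL : IsStableMetzler L) (hδ : IsCNI δ)
    (hβ : 0 ≤ β) (hTβ : tMap L δ 0 β ≤ β) :
    ∃ b, Tendsto (fun m : ℕ => (tMap L δ 0)^[m] β) atTop (𝓝 b) ∧ 0 ≤ b := by
  have hnonneg : ∀ m, 0 ≤ (tMap L δ 0)^[m] β := fun m =>
    (hL.mapsTo_tMap hδ.mapsTo le_rfl).iterate m hβ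
  have hlim := tendsto_atTop_ciInf (hL.antitone_iterate_tMap hδ hβ hTβ)
    ⟨0, forall_mem_range.2 hnonneg⟩
  exact ⟨_, hlim, ge_of_tendsto' hlim hnonneg⟩

theorem IsStableMetzler.le_iterate_tMap (hL : IsStableMetzler L) (hδ : IsCNI δ) {l : Fin n → ℝ}
    (hl : 0 ≤ l) (hTl : l ≤ tMap L δ 0 l) (hlβ : l ≤ β) (m : ℕ) : l ≤ (tMap L δ 0)^[m] β := by
  induction m with
  | zero => exact hlβ
  | succ m ih =>
    rw [Function.iterate_succ_apply']
    exact hTl.trans (hL.monotoneOn_tMap hδ.monotoneOn 0 hl (hl.trans ih) ih)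

theorem IsStableMetzler.mulVec_tMap_zero_add (hL : IsStableMetzler L) (x : Fin n → ℝ) :
    L *ᵥ tMap L δ 0 x + δ x = 0 := by
  rw [tMap, add_zero, Matrix.mulVec_neg, hL.mulVec_inv_mulVec, neg_add_cancel]

theorem IsStableMetzler.tMap_le_neg_inv_mulVec (hL : IsStableMetzler L)
    (δ : (Fin n → ℝ) → Fin n → ℝ) (β γ : Fin n → ℝ) :
    tMap L δ γ β ≤ -(L⁻¹ *ᵥ (δ β + (-(L *ᵥ γ)) ⊔ 0)) := by
  have hγ : γ ≤ -(L⁻¹ *ᵥ ((-(L *ᵥ γ)) ⊔ 0)) := by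
    simpa only [Matrix.mulVec_neg, neg_neg, hL.inv_mulVec_mulVec] using
      hL.monotone_neg_inv_mulVec (le_sup_left : -(L *ᵥ γ) ≤ (-(L *ᵥ γ)) ⊔ 0)
  rw [Matrix.mulVec_add, neg_add]
  exact add_le_add_right hγ _

end ComparisonMap

section Admissible

variable {n : ℕ} {L : Matrix (Fin n) (Fin n) ℝ} {δ : (Fin n → ℝ) → Fin n → ℝ}
  {β c : Fin n → ℝ}

theorem pVec_eq_sup (L : Matrix (Fin n) (Fin n) ℝ) (c : Fin n → ℝ) :
    pVec L c = (-(L *ᵥ c)) ⊔ 0 :=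
  funext fun _ => (max_def_lt 0 _).symm.trans (max_comm _ _)

theorem IsStableMetzler.pVec_ne_zero [NeZero n] (hL : IsStableMetzler L) (hc : StrongLT 0 c) :
    pVec L c ≠ 0 := by
  intro hzero
  rw [pVec_eq_sup, sup_eq_right] at hzero
  have hneg : 0 ≤ -c := hL.nonneg_of_mulVec_nonpos (by rwa [Matrix.mulVec_neg])
  exact (neg_nonneg.1 (hneg 0)).not_gt (hc 0)

theorem IsStableMetzler.pSupport_nonempty [NeZero n] (hL : IsStableMetzler L)
    (hc : StrongLT 0 c) : (pSupport L c).Nonempty := by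
  have hne : -(L⁻¹ *ᵥ pVec L c) ≠ 0 := fun h => hL.pVec_ne_zero hc <| by
    rw [← hL.mulVec_inv_mulVec (pVec L c), neg_eq_zero.1 h, Matrix.mulVec_zero]
  obtain ⟨j, hj⟩ := Function.ne_iff.1 hne
  exact ⟨j, Finset.mem_filter.2 ⟨Finset.mem_univ j, hj⟩⟩

theorem IsStableMetzler.neg_inv_mulVec_pVec_pos (hL : IsStableMetzler L) {j : Fin n}
    (hj : j ∈ pSupport L c) : 0 < (-(L⁻¹ *ᵥ pVec L c)) j :=
  (hL.neg_inv_mulVec_nonneg (pVec_eq_sup L c ▸ le_sup_right) j).lt_of_ne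
    (Finset.mem_filter.1 hj).2.symm

theorem strongLT_add_inv_mulVec (hTβ : StrongLT (tMap L δ 0 β) β) :
    StrongLT 0 (β + L⁻¹ *ᵥ δ β) := fun j => by
  have hj : (-(L⁻¹ *ᵥ δ β)) j + 0 < β j := hTβ j
  rw [add_zero, Pi.neg_apply] at hj
  exact neg_lt_iff_pos_add.1 hj

theorem IsStableMetzler.epsBar_pos (hL : IsStableMetzler L) (hTβ : StrongLT (tMap L δ 0 β) β)
    (hne : (pSupport L c).Nonempty) : 0 < epsBar L δ β c hne :=
  (Finset.lt_inf'_iff hne).2 fun j hj =>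
    div_pos (strongLT_add_inv_mulVec hTβ j) (hL.neg_inv_mulVec_pVec_pos hj)

theorem IsStableMetzler.admissible_smul (hL : IsStableMetzler L)
    (hTβ : StrongLT (tMap L δ 0 β) β) (hne : (pSupport L c).Nonempty) {ε : ℝ} (hε : 0 < ε)
    (hlt : ε < epsBar L δ β c hne) : Admissible L δ β (ε • c) := by
  have hsup : (-(L *ᵥ (ε • c))) ⊔ 0 = ε • pVec L c := by
    rw [pVec_eq_sup, Matrix.mulVec_smul, ← smul_neg]
    ext j
    simpa using (mul_max_of_nonneg ((-(L *ᵥ c)) j) 0 hε.le).symm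
  have hkey : ∀ j, ε * (-(L⁻¹ *ᵥ pVec L c)) j < (β + L⁻¹ *ᵥ δ β) j := by
    intro j
    by_cases hj : j ∈ pSupport L c
    · exact (lt_div_iff₀ (hL.neg_inv_mulVec_pVec_pos hj)).1 ((Finset.lt_inf'_iff hne).1 hlt j hj)
    · have hzero : (-(L⁻¹ *ᵥ pVec L c)) j = 0 := by
        simpa only [pSupport, Finset.mem_filter, Finset.mem_univ, true_and, not_not] using hj
      rw [hzero, mul_zero]
      exact strongLT_add_inv_mulVec hTβ j
  intro j
  have hj := hkey j
  rw [hsup, Matrix.mulVec_add, Matrix.mulVec_smul]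
  simp only [Pi.neg_apply, Pi.add_apply, Pi.smul_apply, smul_eq_mul] at hj ⊢
  linarith

end Admissible

namespace IsDelaySubsolution

variable {n : ℕ} {L : Matrix (Fin n) (Fin n) ℝ} {δ : (Fin n → ℝ) → Fin n → ℝ} {τ : ℝ}
  {u : ℝ → Fin n → ℝ} {β γ : Fin n → ℝ}

theorem le_of_admissible (hu : IsDelaySubsolution L δ τ u) (hL : IsStableMetzler L) (hτ : 0 ≤ τ)
    (hγ : Admissible L δ β γ) (hinit : ∀ t ∈ Icc (-τ) 0, u t ≤ tMap L δ γ β) {t : ℝ}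
    (ht : -τ ≤ t) : u t ≤ β := by
  refine hu.le_of_initial_le hL ?_ hγ hτ
    (fun s hs => (hinit s hs).trans (hL.tMap_le_neg_inv_mulVec δ β γ)) ht
  rw [Matrix.mulVec_neg, hL.mulVec_inv_mulVec, neg_add_rev, neg_add_cancel_right]
  exact neg_nonpos.2 le_sup_right

theorem limsup_le_tMap (hu : IsDelaySubsolution L δ τ u) (hL : IsStableMetzler L)
    (hδ : ContinuousOn δ (orthant n)) {l : Fin n → ℝ} (hl : 0 ≤ l)
    (hlu : ∀ ε > (0 : ℝ), ∀ᶠ t in atTop, u t ≤ l + fun _ => ε) (j : Fin n) :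
    limsup (fun t => u t j) atTop ≤ tMap L δ 0 l j := by
  have hpath : Tendsto (fun ε : ℝ => l + fun _ => ε) (𝓝[>] 0) (𝓝[orthant n] l) := by
    refine tendsto_nhdsWithin_iff.2 ⟨?_, ?_⟩
    · have hcont : Continuous fun ε : ℝ => l + fun _ => ε := by fun_prop
      exact (hcont.tendsto' 0 l (add_zero l)).mono_left nhdsWithin_le_nhds
    · filter_upwards [self_mem_nhdsWithin] with ε hε using add_nonneg hl fun _ => le_of_lt hε
  have hlim := tendsto_pi_nhds.1 ((continuousOn_tMap hδ L 0 l hl).tendsto.comp hpath) j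
  refine ge_of_tendsto hlim ?_
  filter_upwards [self_mem_nhdsWithin] with ε hε
  exact hu.limsup_le hL (hL.mulVec_tMap_zero_add _).le (hlu ε hε) j

theorem limsup_le_of_tendsto_iterate_tMap (hu : IsDelaySubsolution L δ τ u)
    (hL : IsStableMetzler L) (hδ : ContinuousOn δ (orthant n)) (hδ_cni : IsCNI δ)
    (hle : ∀ᶠ t in atTop, u t ≤ β) {b : Fin n → ℝ}
    (hb : Tendsto (fun m : ℕ => (tMap L δ 0)^[m] β) atTop (𝓝 b)) (j : Fin n) :
    limsup (fun t => u t j) atTop ≤ b j := by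
  set l : Fin n → ℝ := fun i => limsup (fun t => u t i) atTop
  have hbdd : ∀ i, IsBoundedUnder (· ≤ ·) atTop fun t => u t i := fun i =>
    isBoundedUnder_of_eventually_le (hle.mono fun t ht => ht i)
  have hl : 0 ≤ l := fun i =>
    le_limsup_of_frequently_le (Frequently.of_forall fun t => hu.nonneg t i) (hbdd i)
  have hlβ : l ≤ β := fun i => limsup_le_of_le
    (isCoboundedUnder_le_of_le atTop fun t => hu.nonneg t i) (hle.mono fun t ht => ht i)
  have hTl : l ≤ tMap L δ 0 l := hu.limsup_le_tMap hL hδ hl fun ε hε =>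
    (eventually_all.2 fun i => eventually_lt_of_limsup_lt (lt_add_of_pos_right (l i) hε)
      (hbdd i)).mono fun t ht i => (ht i).le
  exact ge_of_tendsto' hb (hL.le_iterate_tMap hδ_cni hl hTl hlβ) j

end IsDelaySubsolution

section Modulus

theorem norm_mulVec_le_absMat_mulVec {n m : ℕ} (B : Matrix (Fin n) (Fin m) ℂ) {z : Fin m → ℂ}
    {u : Fin m → ℝ} (h : ∀ l, ‖z l‖ ≤ u l) (j : Fin n) : ‖(B *ᵥ z) j‖ ≤ (absMat B *ᵥ u) j := by
  refine (norm_sum_le Finset.univ fun l => B j l * z l).trans (Finset.sum_le_sum fun l _ => ?_)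
  rw [norm_mul]
  exact mul_le_mul_of_nonneg_left (h l) (norm_nonneg _)

theorem absMat_mulVec_nonneg {n m : ℕ} (B : Matrix (Fin n) (Fin m) ℂ) {u : Fin m → ℝ}
    (hu : 0 ≤ u) : 0 ≤ absMat B *ᵥ u := fun j =>
  Finset.sum_nonneg (s := Finset.univ) fun l _ => mul_nonneg (norm_nonneg (B j l)) (hu l)

theorem re_mul_mulVec_le {n : ℕ} {B : Matrix (Fin n) (Fin n) ℂ} {L : Matrix (Fin n) (Fin n) ℝ}
    (hBL : ∀ j l, metzlerPart B j l ≤ L j l) {z : Fin n → ℂ} {j : Fin n} {φ : ℂ}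
    (hφ : ‖φ‖ = 1) (hφz : φ * z j = ‖z j‖) :
    (φ * (B *ᵥ z) j).re ≤ (L *ᵥ fun l => ‖z l‖) j := by
  simp only [Matrix.mulVec, dotProduct, Finset.mul_sum, Complex.re_sum]
  refine Finset.sum_le_sum fun l _ =>
    le_trans ?_ (mul_le_mul_of_nonneg_right (hBL j l) (norm_nonneg _))
  obtain rfl | hjl := eq_or_ne j l
  · rw [mul_left_comm, hφz, Complex.re_mul_ofReal]
    simp [metzlerPart]
  · refine (Complex.re_le_norm _).trans ?_
    simp [metzlerPart, hjl, hφ]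

/-- The difference `‖z s‖ - Re (φ * z s)` is minimal at `s = t`. -/
theorem deriv_norm_eq_re_mul {z : ℝ → ℂ} {y φ : ℂ} {t d : ℝ} (hz : HasDerivAt z y t)
    (hd : HasDerivAt (fun s => ‖z s‖) d t) (hφ : ‖φ‖ = 1) (hφz : φ * z t = ‖z t‖) :
    d = (φ * y).re := by
  have hre : HasDerivAt (fun s => (φ * z s).re) (φ * y).re t :=
    Complex.reCLM.hasFDerivAt.comp_hasDerivAt t (hz.const_mul φ)
  have hmin : IsLocalMin (fun s => ‖z s‖ - (φ * z s).re) t := Eventually.of_forall fun s => by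
    simp only [hφz, Complex.ofReal_re, sub_self, sub_nonneg]
    simpa [hφ] using Complex.re_le_norm (φ * z s)
  exact sub_eq_zero.1 (hmin.hasDerivAt_eq_zero (hd.sub hre))

theorem deriv_norm_le_of_metzlerPart_le {n : ℕ} {B : Matrix (Fin n) (Fin n) ℂ}
    {L : Matrix (Fin n) (Fin n) ℝ} (hBL : ∀ j l, metzlerPart B j l ≤ L j l)
    {z : ℝ → Fin n → ℂ} {q : Fin n → ℂ} {t : ℝ} {d : Fin n → ℝ}
    (hz : HasDerivAt z (B *ᵥ z t + q) t) (hd : HasDerivAt (fun s l => ‖z s l‖) d t) (j : Fin n) :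
    d j ≤ (L *ᵥ fun l => ‖z t l‖) j + ‖q j‖ := by
  obtain ⟨φ, hφ, hφz⟩ := Complex.exists_norm_eq_mul_self (z t j)
  rw [deriv_norm_eq_re_mul (hasDerivAt_pi.1 hz j) (hasDerivAt_pi.1 hd j) hφ hφz.symm,
    Pi.add_apply, mul_add, Complex.add_re]
  refine add_le_add (re_mul_mulVec_le hBL hφ hφz.symm) ((Complex.re_le_norm _).trans_eq ?_)
  rw [norm_mul, hφ, one_mul]

end Modulus

section Trajectory

/-- The map `x ↦ B x` on real vectors, for a complex matrix `B`; `absMulVec B x` is the vector of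
moduli of its value. -/
noncomputable def mulVecCLM {n m : ℕ} (B : Matrix (Fin n) (Fin m) ℂ) :
    (Fin m → ℝ) →L[ℝ] (Fin n → ℂ) :=
  LinearMap.toContinuousLinearMap
    ((B.mulVecLin.restrictScalars ℝ) ∘ₗ (Complex.ofRealCLM.toLinearMap.compLeft (Fin m)))

theorem mulVecCLM_apply {n m : ℕ} (B : Matrix (Fin n) (Fin m) ℂ) (x : Fin m → ℝ) :
    mulVecCLM B x = B *ᵥ fun l => (x l : ℂ) :=
  rfl

theorem mulVecCLM_mulVec {n m p : ℕ} (B : Matrix (Fin n) (Fin m) ℂ)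
    (M : Matrix (Fin m) (Fin p) ℝ) (x : Fin p → ℝ) :
    mulVecCLM B (M *ᵥ x) = mulVecCLM (B * M.map Complex.ofReal) x := by
  rw [mulVecCLM_apply, mulVecCLM_apply, ← Matrix.mulVec_mulVec]
  congr 1
  ext l
  simp [Matrix.mulVec, dotProduct]

theorem lipschitzWith_absMulVec {n m : ℕ} (B : Matrix (Fin n) (Fin m) ℂ) :
    LipschitzWith ‖mulVecCLM B‖₊ (absMulVec B) := by
  refine LipschitzWith.of_dist_le_mul fun x y => (dist_pi_le_iff (by positivity)).2 fun j => ?_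
  calc dist (absMulVec B x j) (absMulVec B y j)
      ≤ dist (mulVecCLM B x j) (mulVecCLM B y j) := by
        rw [dist_eq_norm (mulVecCLM B x j)]
        exact dist_norm_norm_le _ _
    _ ≤ dist (mulVecCLM B x) (mulVecCLM B y) := dist_le_pi_dist _ _ j
    _ ≤ ‖mulVecCLM B‖₊ * dist x y := (mulVecCLM B).lipschitz.dist_le_mul x y

theorem delayMax_nonneg {n : ℕ} (τ : ℝ) (x : ℝ → Fin n → ℝ) (t : ℝ) : 0 ≤ delayMax τ x t :=
  fun j => Real.sSup_nonneg (forall_mem_image.2 fun s _ => abs_nonneg (x s j))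

variable {n : ℕ} {V : Matrix (Fin n) (Fin n) ℂ} {τ : ℝ} {x : ℝ → Fin n → ℝ}

theorem mulVec_mulVecCLM_inv (hV : IsUnit V) (x : Fin n → ℝ) :
    V *ᵥ mulVecCLM V⁻¹ x = fun l => (x l : ℂ) := by
  rw [mulVecCLM_apply, Matrix.mulVec_mulVec,
    Matrix.mul_nonsing_inv _ ((Matrix.isUnit_iff_isUnit_det _).1 hV), Matrix.one_mulVec]

theorem hasDerivAt_mulVecCLM_inv (hV : IsUnit V) {m : ℕ} {M : Matrix (Fin n) (Fin n) ℝ}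
    {K : Matrix (Fin n) (Fin m) ℝ} {ω : Fin m → ℝ} {t : ℝ}
    (h : HasDerivAt x (M *ᵥ x t + K *ᵥ ω) t) :
    HasDerivAt (fun s => mulVecCLM V⁻¹ (x s))
      ((V⁻¹ * M.map Complex.ofReal * V) *ᵥ mulVecCLM V⁻¹ (x t) +
        mulVecCLM (V⁻¹ * K.map Complex.ofReal) ω) t := by
  have hrhs := (mulVecCLM V⁻¹).hasFDerivAt.comp_hasDerivAt t h
  rwa [map_add, mulVecCLM_mulVec, mulVecCLM_mulVec, mulVecCLM_apply (_ * M.map _),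
    ← mulVec_mulVecCLM_inv hV, Matrix.mulVec_mulVec] at hrhs

theorem abs_le_absMat_mulVec (hV : IsUnit V) {x ζ : Fin n → ℝ} (h : absMulVec V⁻¹ x ≤ ζ) :
    |x| ≤ absMat V *ᵥ ζ := fun j => by
  have hj := norm_mulVec_le_absMat_mulVec V (z := mulVecCLM V⁻¹ x) h j
  rwa [mulVec_mulVecCLM_inv hV, Complex.norm_real] at hj

theorem delayMax_le (hτ : 0 ≤ τ) {t : ℝ} {y : Fin n → ℝ} (h : ∀ s ∈ Icc (t - τ) t, |x s| ≤ y) :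
    delayMax τ x t ≤ y := fun j =>
  csSup_le ((nonempty_Icc.2 (sub_le_self t hτ)).image _) (forall_mem_image.2 fun s hs => h s hs j)

variable {N : ℕ} [NeZero N] {k : Fin N → ℕ} {A : Fin N → Matrix (Fin n) (Fin n) ℝ}
  {H : ∀ i, Matrix (Fin n) (Fin (k i)) ℝ} {dl : ∀ i, (Fin n → ℝ) → (Fin (k i) → ℝ)}
  {σ : ℝ → Fin N} {w : ∀ i, ℝ → Fin (k i) → ℝ}

theorem metzlerPart_le_lamMat (V : Matrix (Fin n) (Fin n) ℂ)
    (A : Fin N → Matrix (Fin n) (Fin n) ℝ) (i : Fin N) (j l : Fin n) :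
    metzlerPart (V⁻¹ * (A i).map Complex.ofReal * V) j l ≤ lamMat V A j l :=
  Finset.le_sup' (fun i => metzlerPart (V⁻¹ * (A i).map Complex.ofReal * V) j l)
    (Finset.mem_univ i)

theorem absMulVec_le_psi (V : Matrix (Fin n) (Fin n) ℂ)
    (H : ∀ i, Matrix (Fin n) (Fin (k i)) ℝ) (y : Fin n → ℝ) {i : Fin N}
    {ω : Fin (k i) → ℝ} (hω : |ω| ≤ dl i (absMat V *ᵥ y)) :
    absMulVec (V⁻¹ * (H i).map Complex.ofReal) ω ≤ psi V H dl y := by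
  intro j
  have hbdd : BddAbove ((fun ω : Fin (k i) → ℝ =>
      absMulVec (V⁻¹ * (H i).map Complex.ofReal) ω j) '' {ω | |ω| ≤ dl i (absMat V *ᵥ y)}) :=
    ⟨(absMat (V⁻¹ * (H i).map Complex.ofReal) *ᵥ dl i (absMat V *ᵥ y)) j,
      forall_mem_image.2 fun ω hω => norm_mulVec_le_absMat_mulVec _
        (fun l => (Complex.norm_real _).trans_le (hω l)) j⟩
  exact (le_csSup hbdd (mem_image_of_mem _ hω)).trans (Finset.le_sup' (fun i =>
    sSup ((fun ω : Fin (k i) → ℝ => absMulVec (V⁻¹ * (H i).map Complex.ofReal) ω j) ''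
      {ω | |ω| ≤ dl i (absMat V *ᵥ y)})) (Finset.mem_univ i))

variable {L : Matrix (Fin n) (Fin n) ℝ} {δ : (Fin n → ℝ) → Fin n → ℝ}

theorem IsTrajectory.absMulVec_perturbation_le (hx : IsTrajectory A H dl τ σ w x)
    (hdl : ∀ i, MonotoneOn (dl i) (orthant n)) (hτ : 0 ≤ τ) (hV : IsUnit V)
    (hψ : ∀ y ∈ orthant n, psi V H dl y ≤ δ y) {t : ℝ} (ht : 0 ≤ t) {ζ : Fin n → ℝ}
    (hζ : ∀ s ∈ Icc (t - τ) t, absMulVec V⁻¹ (x s) ≤ ζ) (i : Fin N) :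
    absMulVec (V⁻¹ * (H i).map Complex.ofReal) (w i t) ≤ δ ζ := by
  have hζ0 : 0 ≤ ζ := fun j =>
    (norm_nonneg _).trans (hζ t (right_mem_Icc.2 (sub_le_self t hτ)) j)
  have hdelay : delayMax τ x t ≤ absMat V *ᵥ ζ :=
    delayMax_le hτ fun s hs => abs_le_absMat_mulVec hV (hζ s hs)
  exact (absMulVec_le_psi V H ζ ((hx.bound t ht i).trans (hdl i (delayMax_nonneg τ x t)
    (absMat_mulVec_nonneg V hζ0) hdelay))).trans (hψ ζ hζ0)

theorem IsTrajectory.isDelaySubsolution (hx : IsTrajectory A H dl τ σ w x)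
    (hdl : ∀ i, MonotoneOn (dl i) (orthant n)) (hτ : 0 ≤ τ) (hV : IsUnit V)
    (hAL : ∀ i j l, metzlerPart (V⁻¹ * (A i).map Complex.ofReal * V) j l ≤ L j l)
    (hψ : ∀ y ∈ orthant n, psi V H dl y ≤ δ y) :
    IsDelaySubsolution L δ τ fun t => absMulVec V⁻¹ (x t) where
  nonneg _ _ := norm_nonneg _
  absolutelyContinuous t ht := absolutelyContinuousOnInterval_comp_of_lipschitzWith
    (lipschitzWith_absMulVec V⁻¹) (hx.absolutelyContinuous t ht)
  deriv_le := by
    filter_upwards [hx.ode] with t hode ht ζ hζ u' hu' j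
    exact (deriv_norm_le_of_metzlerPart_le (hAL (σ t))
      (hasDerivAt_mulVecCLM_inv hV (hode ht)) hu' j).trans
      (add_le_add_right (hx.absMulVec_perturbation_le hdl hτ hV hψ ht hζ (σ t) j) _)

end Trajectory

end SwitchingSystem

open SwitchingSystem in
theorem mainTheorem1_general {n N : ℕ} [NeZero n] [NeZero N] {k : Fin N → ℕ}
    (A : Fin N → Matrix (Fin n) (Fin n) ℝ) (H : ∀ i, Matrix (Fin n) (Fin (k i)) ℝ)
    (dl : ∀ i, (Fin n → ℝ) → (Fin (k i) → ℝ)) (hdl_cni : ∀ i, IsCNI (dl i)) (τ : ℝ) (hτ : 0 ≤ τ)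
    (V : Matrix (Fin n) (Fin n) ℂ) (hV : IsUnit V)
    (L : Matrix (Fin n) (Fin n) ℝ)
    (hL : ∀ i j l, metzlerPart (V⁻¹ * (A i).map Complex.ofReal * V) j l ≤ L j l)
    (hHurwitz : IsHurwitz L)
    (δ : (Fin n → ℝ) → (Fin n → ℝ)) (hδ_cont : ContinuousOn δ (orthant n)) (hδ_cni : IsCNI δ)
    (hδ_psi : ∀ x ∈ orthant n, psi V H dl x ≤ δ x)
    (β : Fin n → ℝ) (hβ : 0 ≤ β) (hTβ : StrongLT (tMap L δ 0 β) β) :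
    (∀ γ, 0 ≤ γ → MapsTo (tMap L δ γ) (orthant n) (orthant n)) ∧
    ∃ b : Fin n → ℝ,
      ((∀ m : ℕ, (tMap L δ 0)^[m + 1] β ≤ (tMap L δ 0)^[m] β) ∧
        Tendsto (fun m : ℕ => (tMap L δ 0)^[m] β) atTop (𝓝 b) ∧ 0 ≤ b) ∧
      (∀ γ, Admissible L δ β γ →
        ∀ σ w x, IsTrajectory A H dl τ σ w x →
          (∀ t, -τ ≤ t → t ≤ 0 → absMulVec V⁻¹ (x t) ≤ tMap L δ γ β) →
          ∀ t, -τ ≤ t → absMulVec V⁻¹ (x t) ≤ β) ∧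
      (∀ c : Fin n → ℝ, StrongLT 0 c →
        pVec L c ≠ 0 ∧ ∃ h : (pSupport L c).Nonempty, 0 < epsBar L δ β c h ∧
          ∀ ε : ℝ, 0 < ε → ε < epsBar L δ β c h → Admissible L δ β (ε • c)) ∧
      (∀ σ w x, IsTrajectory A H dl τ σ w x →
        (∀ t, -τ ≤ t → absMulVec V⁻¹ (x t) ≤ β) →
        ∀ j, limsup (fun t => absMulVec V⁻¹ (x t) j) atTop ≤ b j) := by
  have hMetzler : IsMetzler L := fun j l hjl =>
    (norm_nonneg _).trans (by simpa [metzlerPart, hjl] using hL 0 j l)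
  have hStable : IsStableMetzler L :=
    hMetzler.isStableMetzler_of_spectrum_neg fun _ => hHurwitz.neg_of_mem_spectrum
  have hsub : ∀ {σ w x}, IsTrajectory A H dl τ σ w x →
      IsDelaySubsolution L δ τ fun t => absMulVec V⁻¹ (x t) := fun hx =>
    hx.isDelaySubsolution (fun i => (hdl_cni i).monotoneOn) hτ hV hL hδ_psi
  obtain ⟨b, hb, hb0⟩ := hStable.exists_tendsto_iterate_tMap hδ_cni hβ hTβ.le
  refine ⟨fun γ hγ => hStable.mapsTo_tMap hδ_cni.mapsTo hγ, b,
    ⟨fun m => hStable.antitone_iterate_tMap hδ_cni hβ hTβ.le m.le_succ, hb, hb0⟩, ?_, ?_, ?_⟩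
  · intro γ hγ σ w x hx hinit t ht
    exact (hsub hx).le_of_admissible hStable hτ hγ (fun s hs => hinit s hs.1 hs.2) ht
  · intro c hc
    have hne := hStable.pSupport_nonempty hc
    exact ⟨hStable.pVec_ne_zero hc, hne, hStable.epsBar_pos hTβ hne,
      fun ε => hStable.admissible_smul hTβ hne⟩
  · intro σ w x hx hle
    exact (hsub hx).limsup_le_of_tendsto_iterate_tMap hStable hδ_cont hδ_cni
      (eventually_atTop.2 ⟨-τ, hle⟩) hb

theorem mainTheorem1 {n N : ℕ} [NeZero n] [NeZero N] {k : Fin N → ℕ}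
    (A : Fin N → Matrix (Fin n) (Fin n) ℝ) (H : ∀ i, Matrix (Fin n) (Fin (k i)) ℝ)
    (dl : ∀ i, (Fin n → ℝ) → (Fin (k i) → ℝ))
    (hdl_cont : ∀ i, ContinuousOn (dl i) (SwitchingSystem.orthant n))
    (hdl_cni : ∀ i, SwitchingSystem.IsCNI (dl i))
    (τ : ℝ) (hτ : 0 ≤ τ)
    (V : Matrix (Fin n) (Fin n) ℂ) (hV : IsUnit V)
    (L : Matrix (Fin n) (Fin n) ℝ) (hL : L = SwitchingSystem.lamMat V A)
    (hHurwitz : SwitchingSystem.IsHurwitz L)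
    (δ : (Fin n → ℝ) → (Fin n → ℝ))
    (hδ_cont : ContinuousOn δ (SwitchingSystem.orthant n))
    (hδ_cni : SwitchingSystem.IsCNI δ)
    (hδ_psi : ∀ x ∈ SwitchingSystem.orthant n, SwitchingSystem.psi V H dl x ≤ δ x)
    (β : Fin n → ℝ) (hβ : 0 ≤ β)
    (hTβ : StrongLT (SwitchingSystem.tMap L δ 0 β) β) :
    -- the maps `T_γ` are maps of the nonnegative orthant to itself
    (∀ γ, 0 ≤ γ → Set.MapsTo (SwitchingSystem.tMap L δ γ)
      (SwitchingSystem.orthant n) (SwitchingSystem.orthant n)) ∧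
    ∃ b : Fin n → ℝ,
      -- (a)
      ((∀ m : ℕ, (SwitchingSystem.tMap L δ 0)^[m + 1] β ≤ (SwitchingSystem.tMap L δ 0)^[m] β) ∧
        Filter.Tendsto (fun m : ℕ => (SwitchingSystem.tMap L δ 0)^[m] β) Filter.atTop (nhds b) ∧
        0 ≤ b) ∧
      -- (b)
      (∀ γ, 0 ≤ γ → SwitchingSystem.Admissible L δ β γ →
        ∀ σ w x, SwitchingSystem.IsTrajectory A H dl τ σ w x →
          (∀ t, -τ ≤ t → t ≤ 0 →
            SwitchingSystem.absMulVec V⁻¹ (x t) ≤ SwitchingSystem.tMap L δ γ β) →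
          ∀ t, -τ ≤ t → SwitchingSystem.absMulVec V⁻¹ (x t) ≤ β) ∧
      -- (c)
      (∀ c : Fin n → ℝ, StrongLT 0 c →
        SwitchingSystem.pVec L c ≠ 0 ∧
        ∃ h : (SwitchingSystem.pSupport L c).Nonempty,
          0 < SwitchingSystem.epsBar L δ β c h ∧
          ∀ ε : ℝ, 0 < ε → ε < SwitchingSystem.epsBar L δ β c h →
            SwitchingSystem.Admissible L δ β (ε • c)) ∧
      -- (d)
      (∀ σ w x, SwitchingSystem.IsTrajectory A H dl τ σ w x →
        (∀ t, -τ ≤ t → SwitchingSystem.absMulVec V⁻¹ (x t) ≤ β) →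
        ∀ j, Filter.limsup (fun t => SwitchingSystem.absMulVec V⁻¹ (x t) j) Filter.atTop ≤ b j) := by
  obtain ⟨hmaps, b, ha, hb, hcd⟩ := mainTheorem1_general A H dl hdl_cni τ hτ V hV L
    (hL ▸ SwitchingSystem.metzlerPart_le_lamMat V A) hHurwitz δ hδ_cont hδ_cni hδ_psi β hβ hTβ
  exact ⟨hmaps, b, ha, fun γ _ => hb γ, hcd⟩
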